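/- For $q>0$ and $x>0$ let $\Gamma_q(x)$ be the $q$-gamma function: $$\Gamma_q(x)=(1-q)^{1-x}\prod_{n=0}^\infty\frac{1-q^{n+1}}{1-q^{n+x}}\quad(0<q<1),\qquad \Gamma_q(x)=(q-1)^{1-x}q^{x(x-1)/2}\prod_{n=0}^\infty\frac{1-q^{-(n+1)}}{1-q^{-(n+x)}}\quad(q>1),$$ and $\Gamma_1(x)=\Gamma(x)$. Let $\psi_q(x)=\Gamma_q'(x)/\Gamma_q(x)$, where $'$ is the derivative in $x$, and let $$J=\{q>0:\ \psi_q(1)-\psi_q(1)^2+\psi_q'(1)\ge 0\}.$$ Then for every $q\in J$ and every $x>0$, $$\Gamma_q(x)+\Gamma_q(1/x)\ge 2\qquad\text{and}\qquad \Gamma_q(x)\,\Gamma_q(1/x)\ge 1.$$ Moreover $1\in J$, so that the case $q=1$ contains Gautschi's inequalities $\Gamma(x)+\Gamma(1/x)\ge 2$ and $\Gamma(x)\Gamma(1/x)\ge 1$ for the classical gamma function. -/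

import Mathlib

noncomputable section

/-- The `q`-gamma function `Γ_q(x)` (used for `q > 0`, `x > 0`): Jackson's products for
`0 < q < 1` and for `q > 1`, and Euler's gamma function for `q = 1`. -/
def qGamma (q x : ℝ) : ℝ :=
  if q < 1 then
    (1 - q) ^ (1 - x) * ∏' n : ℕ, (1 - q ^ ((n : ℝ) + 1)) / (1 - q ^ ((n : ℝ) + x))
  else if q = 1 then
    Real.Gamma x
  else
    (q - 1) ^ (1 - x) * q ^ (x * (x - 1) / 2) *
      ∏' n : ℕ, (1 - q ^ (-((n : ℝ) + 1))) / (1 - q ^ (-((n : ℝ) + x)))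

/-- The `q`-digamma function `ψ_q(x) = Γ_q'(x) / Γ_q(x)`, the derivative being in `x`. -/
def qDigamma (q x : ℝ) : ℝ :=
  deriv (qGamma q) x / qGamma q x

/-- The set `J = {q > 0 : ψ_q(1) - ψ_q(1)² + ψ_q'(1) ≥ 0}`. -/
def qGammaSetJ : Set ℝ :=
  {q : ℝ | 0 < q ∧ 0 ≤ qDigamma q 1 - (qDigamma q 1) ^ 2 + deriv (qDigamma q) 1}

end

/-!
By the inequality between arithmetic and geometric means it is enough to bound the product
`Γ_q(x) Γ_q(1/x)` below by `1`, and this bound holds for every `q > 0`.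

Suppose `0 < q ≤ 1`. The function `log Γ_q` is convex and vanishes at `1` and `2`, which forces
`log Γ_q (1 + x) + log Γ_q (1 + 1/x) ≥ 0` (`ConvexOn.nonneg_add_of_eq_zero`). The functional
equation `Γ_q(1 + x) = [x] Γ_q(x)`, with `[x] = (1 - q^x) / (1 - q)` (and `[x] = x` if `q = 1`),
turns this into the claim, because `[x] [1/x] ≤ 1`. That last inequality is midpoint concavity of
`u ↦ log (1 - exp (-exp u))` (`one_sub_rpow_mul_le`).

For `q > 1` one has `Γ_q(x) = q^((x-1)(x-2)/2) Γ_{1/q}(x)`, and the exponents at `x` and `1/x` add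
up to `(x-1)²(x²-x+1) / (2x²) ≥ 0`, so this case follows from that of `1/q < 1`.

For `1 ∈ J`: `ψ(1) = -γ` with `γ < 2/3`, while differentiating `ψ(x) = ψ(x+2) - 1/x - 1/(x+1)`,
where `ψ` is increasing by log-convexity, gives `ψ'(1) ≥ 1 + 1/4`, which exceeds
`γ + γ² < 10/9`.
-/

open Set

/-! ### Two convexity inequalities -/

/-- The point `2` is a convex combination of `1 + x` and `1 + 1/x` with weights proportional to
`1` and `x`, and it lies between `1` and the larger of the two. -/
theorem ConvexOn.nonneg_add_of_eq_zero {f : ℝ → ℝ} (hf : ConvexOn ℝ (Ioi 0) f) (h1 : f 1 = 0)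
    (h2 : f 2 = 0) {x : ℝ} (hx : 0 < x) : 0 ≤ f (x + 1) + f (1 / x + 1) := by
  wlog hx1 : 1 ≤ x generalizing x
  · have := this (x := 1 / x) (by positivity) (by rw [le_div_iff₀ hx]; linarith)
    rw [one_div_one_div] at this
    linarith
  have hpos : 0 ≤ f (x + 1) := by
    have := hf.2 (x := 1) (y := x + 1) (by simp) (by simp; linarith)
      (show 0 ≤ (x - 1) / x from div_nonneg (by linarith) hx.le)
      (show 0 ≤ 1 / x by positivity) (by field_simp; ring)
    have e : ((x - 1) / x) • (1 : ℝ) + (1 / x) • (x + 1) = 2 := by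
      simp only [smul_eq_mul]; field_simp; ring
    rw [e, h1, h2] at this
    simp only [smul_eq_mul, mul_zero, zero_add] at this
    exact nonneg_of_mul_nonneg_right this (by positivity)
  have hmid : 0 ≤ f (x + 1) + x * f (1 / x + 1) := by
    have := hf.2 (x := x + 1) (y := 1 / x + 1) (by simp; linarith)
      (by simp only [mem_Ioi]; positivity) (show 0 ≤ 1 / (x + 1) by positivity)
      (show 0 ≤ x / (x + 1) by positivity) (by field_simp; ring)
    have e : (1 / (x + 1)) • (x + 1) + (x / (x + 1)) • (1 / x + 1) = 2 := by
      simp only [smul_eq_mul]; field_simp; ring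
    rw [e, h2] at this
    simp only [smul_eq_mul] at this
    have h := mul_nonneg (by linarith : (0 : ℝ) ≤ x + 1) this
    have e' : (x + 1) * (1 / (x + 1) * f (x + 1) + x / (x + 1) * f (1 / x + 1))
        = f (x + 1) + x * f (1 / x + 1) := by field_simp
    rwa [e'] at h
  have : 0 ≤ x * (f (x + 1) + f (1 / x + 1)) := by nlinarith
  exact nonneg_of_mul_nonneg_right this hx

/-- The reciprocal is the slope of the convex function `exp` between `0` and `t`. -/
theorem antitoneOn_div_exp_sub_one :
    AntitoneOn (fun t : ℝ => t / (Real.exp t - 1)) (Ioi 0) := by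
  intro s hs t ht hst
  simp only [mem_Ioi] at hs ht
  have h := convexOn_exp.secant_mono (a := 0) (x := s) (y := t) (mem_univ _) (mem_univ _)
    (mem_univ _) hs.ne' ht.ne' hst
  simp only [Real.exp_zero, sub_zero] at h
  have h1 : 0 < Real.exp s - 1 := by linarith [Real.add_one_lt_exp hs.ne']
  have h2 : 0 < Real.exp t - 1 := by linarith [Real.add_one_lt_exp ht.ne']
  show t / (Real.exp t - 1) ≤ s / (Real.exp s - 1)
  rw [div_le_div_iff₀ hs ht] at h
  rw [div_le_div_iff₀ h2 h1]
  linarith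

theorem concaveOn_log_one_sub_exp_neg_exp :
    ConcaveOn ℝ univ (fun u : ℝ => Real.log (1 - Real.exp (-Real.exp u))) := by
  have hpos (u : ℝ) : 0 < 1 - Real.exp (-Real.exp u) := by
    have : Real.exp (-Real.exp u) < Real.exp 0 := Real.exp_lt_exp.2 (by linarith [Real.exp_pos u])
    rw [Real.exp_zero] at this
    linarith
  have hd (u : ℝ) : HasDerivAt (fun u : ℝ => Real.log (1 - Real.exp (-Real.exp u)))
      (Real.exp u / (Real.exp (Real.exp u) - 1)) u := by
    have := (((Real.hasDerivAt_exp u).fun_neg.exp).const_sub 1).log (hpos u).ne'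
    convert this using 1
    have h2 : Real.exp (Real.exp u) - 1 ≠ 0 := by
      have := Real.add_one_lt_exp (Real.exp_pos u).ne'
      have := Real.exp_pos u
      linarith
    have h3 := hpos u
    rw [Real.exp_neg] at h3 ⊢
    have h4 := Real.exp_pos (Real.exp u)
    rw [div_eq_div_iff h2 h3.ne']
    field_simp
  refine Antitone.concaveOn_univ_of_deriv (fun u => (hd u).differentiableAt) ?_
  intro u v huv
  rw [(hd u).deriv, (hd v).deriv]
  exact antitoneOn_div_exp_sub_one (Real.exp_pos u) (Real.exp_pos v) (Real.exp_le_exp.2 huv)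

/-- With `[x] = (1 - p^x) / (1 - p)`, this is `[x] [1/x] ≤ 1`. -/
theorem one_sub_rpow_mul_le {p x : ℝ} (hp0 : 0 < p) (hp1 : p < 1) (hx : 0 < x) :
    Real.log (1 - p ^ x) + Real.log (1 - p ^ (1 / x)) ≤ 2 * Real.log (1 - p) := by
  have hL : 0 < -Real.log p := by linarith [Real.log_neg hp0 hp1]
  -- `p ^ t = exp (-exp u)` for `u = log t + log (-log p)`
  have key (t : ℝ) (ht : 0 < t) :
      p ^ t = Real.exp (-Real.exp (Real.log t + Real.log (-Real.log p))) := by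
    rw [Real.exp_add, Real.exp_log ht, Real.exp_log hL, Real.rpow_def_of_pos hp0]
    ring_nf
  have h := concaveOn_log_one_sub_exp_neg_exp.2
    (mem_univ (Real.log x + Real.log (-Real.log p)))
    (mem_univ (Real.log (1 / x) + Real.log (-Real.log p)))
    (show (0 : ℝ) ≤ 1 / 2 by norm_num) (show (0 : ℝ) ≤ 1 / 2 by norm_num) (by norm_num)
  have e : (1 / 2 : ℝ) • (Real.log x + Real.log (-Real.log p)) +
      (1 / 2 : ℝ) • (Real.log (1 / x) + Real.log (-Real.log p))
      = Real.log 1 + Real.log (-Real.log p) := by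
    simp only [smul_eq_mul, one_div, Real.log_inv, Real.log_one]; ring
  simp only [e] at h
  rw [← key x hx, ← key (1 / x) (by positivity), ← key 1 one_pos, Real.rpow_one] at h
  simp only [smul_eq_mul] at h
  linarith

/-! ### The logarithm of Jackson's product -/

/-- `∑ₙ log (1 - p^(n+x))`, the logarithm of the infinite `q`-Pochhammer symbol `(p^x; p)_∞`
for `0 < p < 1` and `x > 0`. -/
noncomputable def logQPochhammer (p x : ℝ) : ℝ :=
  ∑' n : ℕ, Real.log (1 - p ^ ((n : ℝ) + x))

theorem one_sub_rpow_pos {p x : ℝ} (hp0 : 0 < p) (hp1 : p < 1) (hx : 0 < x) :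
    0 < 1 - p ^ x := by
  linarith [Real.rpow_lt_one hp0.le hp1 hx]

theorem summable_log_one_sub_rpow {p : ℝ} (hp0 : 0 < p) (hp1 : p < 1) (x : ℝ) :
    Summable fun n : ℕ => Real.log (1 - p ^ ((n : ℝ) + x)) := by
  have h : Summable fun n : ℕ => -(p ^ ((n : ℝ) + x)) := by
    have := ((summable_geometric_of_lt_one hp0.le hp1).mul_right (p ^ x)).neg
    refine this.congr fun n => ?_
    rw [Real.rpow_add hp0, Real.rpow_natCast]
  simpa [sub_eq_add_neg] using Real.summable_log_one_add_of_summable h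

theorem logQPochhammer_eq_add {p : ℝ} (hp0 : 0 < p) (hp1 : p < 1) (x : ℝ) :
    logQPochhammer p x = Real.log (1 - p ^ x) + logQPochhammer p (x + 1) := by
  rw [logQPochhammer, (summable_log_one_sub_rpow hp0 hp1 x).tsum_eq_zero_add, logQPochhammer]
  simp only [Nat.cast_zero, zero_add, Nat.cast_add, Nat.cast_one]
  congr 2
  ext n
  rw [show (n : ℝ) + 1 + x = n + (x + 1) by ring]

theorem concaveOn_log_one_sub_rpow {p : ℝ} (hp0 : 0 < p) (hp1 : p < 1) :
    ConcaveOn ℝ (Ioi 0) fun x : ℝ => Real.log (1 - p ^ x) := by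
  have hc : ConcaveOn ℝ (Ioi 0) fun x : ℝ => 1 - p ^ x :=
    (concaveOn_const 1 (convex_Ioi 0)).sub
      ((convexOn_rpow_left hp0).subset (subset_univ _) (convex_Ioi 0))
  refine ⟨convex_Ioi 0, fun x hx y hy a b ha hb hab => ?_⟩
  have hx' := one_sub_rpow_pos hp0 hp1 hx
  have hy' := one_sub_rpow_pos hp0 hp1 hy
  refine (strictConcaveOn_log_Ioi.concaveOn.2 hx' hy' ha hb hab).trans ?_
  exact Real.log_le_log (convex_Ioi (0 : ℝ) hx' hy' ha hb hab) (hc.2 hx hy ha hb hab)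

theorem concaveOn_logQPochhammer {p : ℝ} (hp0 : 0 < p) (hp1 : p < 1) :
    ConcaveOn ℝ (Ioi 0) (logQPochhammer p) := by
  have hs := summable_log_one_sub_rpow hp0 hp1
  refine ⟨convex_Ioi 0, fun x hx y hy a b ha hb hab => ?_⟩
  simp only [logQPochhammer, smul_eq_mul]
  rw [← tsum_mul_left, ← tsum_mul_left, ← ((hs x).mul_left a).tsum_add ((hs y).mul_left b)]
  refine (((hs x).mul_left a).add ((hs y).mul_left b)).tsum_le_tsum (fun n => ?_) (hs _)
  have hn : (0 : ℝ) ≤ n := n.cast_nonneg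
  have h := (concaveOn_log_one_sub_rpow hp0 hp1).2 (x := n + x) (y := n + y)
    (by simp only [mem_Ioi] at hx ⊢; linarith) (by simp only [mem_Ioi] at hy ⊢; linarith)
    ha hb hab
  simp only [smul_eq_mul] at h
  rwa [show a * (n + x) + b * (n + y) = n + (a * x + b * y) by linear_combination n * hab] at h

theorem tprod_one_sub_rpow_div {p x : ℝ} (hp0 : 0 < p) (hp1 : p < 1) (hx : 0 < x) :
    ∏' n : ℕ, (1 - p ^ ((n : ℝ) + 1)) / (1 - p ^ ((n : ℝ) + x)) =
      Real.exp (logQPochhammer p 1 - logQPochhammer p x) := by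
  have hs := summable_log_one_sub_rpow hp0 hp1
  have hpos {y : ℝ} (hy : 0 < y) (n : ℕ) : 0 < 1 - p ^ ((n : ℝ) + y) :=
    one_sub_rpow_pos hp0 hp1 (by positivity)
  have hlog (n : ℕ) : Real.log ((1 - p ^ ((n : ℝ) + 1)) / (1 - p ^ ((n : ℝ) + x))) =
      Real.log (1 - p ^ ((n : ℝ) + 1)) - Real.log (1 - p ^ ((n : ℝ) + x)) :=
    Real.log_div (hpos one_pos n).ne' (hpos hx n).ne'
  rw [← Real.rexp_tsum_eq_tprod (fun n => div_pos (hpos one_pos n) (hpos hx n))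
    (((hs 1).sub (hs x)).congr fun n => (hlog n).symm)]
  simp only [hlog, logQPochhammer, (hs 1).tsum_sub (hs x)]

/-! ### The product inequality -/

/-- `log Γ_p(x)` for `0 < p < 1` and `x > 0`. -/
noncomputable def logQGamma (p x : ℝ) : ℝ :=
  (1 - x) * Real.log (1 - p) + (logQPochhammer p 1 - logQPochhammer p x)

theorem qGamma_eq_exp {p x : ℝ} (hp0 : 0 < p) (hp1 : p < 1) (hx : 0 < x) :
    qGamma p x = Real.exp (logQGamma p x) := by
  rw [qGamma, if_pos hp1, tprod_one_sub_rpow_div hp0 hp1 hx, logQGamma, Real.exp_add,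
    Real.rpow_def_of_pos (by linarith : 0 < 1 - p), mul_comm (Real.log _)]

theorem logQGamma_add_one {p : ℝ} (hp0 : 0 < p) (hp1 : p < 1) (x : ℝ) :
    logQGamma p (x + 1) = logQGamma p x + Real.log (1 - p ^ x) - Real.log (1 - p) := by
  simp only [logQGamma, logQPochhammer_eq_add hp0 hp1 x]
  ring

theorem convexOn_logQGamma {p : ℝ} (hp0 : 0 < p) (hp1 : p < 1) :
    ConvexOn ℝ (Ioi 0) (logQGamma p) := by
  refine ⟨convex_Ioi 0, fun x hx y hy a b ha hb hab => ?_⟩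
  have h := (concaveOn_logQPochhammer hp0 hp1).2 hx hy ha hb hab
  simp only [logQGamma, smul_eq_mul] at h ⊢
  obtain rfl : b = 1 - a := by linarith
  linarith

theorem logQGamma_add_nonneg {p x : ℝ} (hp0 : 0 < p) (hp1 : p < 1) (hx : 0 < x) :
    0 ≤ logQGamma p x + logQGamma p (1 / x) := by
  have h1 : logQGamma p 1 = 0 := by simp [logQGamma]
  have h2 : logQGamma p 2 = 0 := by
    have := logQGamma_add_one hp0 hp1 1
    rw [h1, Real.rpow_one] at this
    norm_num at this
    exact this
  have h := (convexOn_logQGamma hp0 hp1).nonneg_add_of_eq_zero h1 h2 hx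
  rw [logQGamma_add_one hp0 hp1, logQGamma_add_one hp0 hp1] at h
  linarith [one_sub_rpow_mul_le hp0 hp1 hx]

theorem qGamma_eq_rpow_mul_qGamma_inv {q : ℝ} (hq : 1 < q) (x : ℝ) :
    qGamma q x = q ^ ((x - 1) * (x - 2) / 2) * qGamma q⁻¹ x := by
  have hq0 : 0 < q := by linarith
  have e : q - 1 = q * (1 - q⁻¹) := by field_simp
  have hp : 0 < 1 - q⁻¹ := by linarith [inv_lt_one_of_one_lt₀ hq]
  rw [qGamma, if_neg hq.not_gt, if_neg hq.ne', qGamma, if_pos (inv_lt_one_of_one_lt₀ hq), e,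
    Real.mul_rpow hq0.le hp.le,
    show (x - 1) * (x - 2) / 2 = (1 - x) + x * (x - 1) / 2 by ring, Real.rpow_add hq0]
  simp only [Real.rpow_neg hq0.le, Real.inv_rpow hq0.le]
  ring

theorem Real.one_le_Gamma_mul_Gamma_one_div {x : ℝ} (hx : 0 < x) :
    1 ≤ Real.Gamma x * Real.Gamma (1 / x) := by
  have hx' : 0 < 1 / x := by positivity
  have h := Real.convexOn_log_Gamma.nonneg_add_of_eq_zero (by simp) (by simp) hx
  simp only [Function.comp_apply] at h
  rw [← Real.log_mul (Real.Gamma_pos_of_pos (by positivity)).ne'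
    (Real.Gamma_pos_of_pos (by positivity)).ne', Real.Gamma_add_one hx.ne',
    Real.Gamma_add_one hx'.ne'] at h
  have e : x * Real.Gamma x * (1 / x * Real.Gamma (1 / x)) = Real.Gamma x * Real.Gamma (1 / x) := by
    field_simp
  rw [e] at h
  exact (Real.log_nonneg_iff
    (mul_pos (Real.Gamma_pos_of_pos hx) (Real.Gamma_pos_of_pos hx'))).1 h

theorem qGamma_pos {q x : ℝ} (hq : 0 < q) (hx : 0 < x) : 0 < qGamma q x := by
  rcases lt_trichotomy q 1 with h | rfl | h
  · rw [qGamma_eq_exp hq h hx]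
    exact Real.exp_pos _
  · simpa [qGamma] using Real.Gamma_pos_of_pos hx
  · rw [qGamma_eq_rpow_mul_qGamma_inv h,
      qGamma_eq_exp (inv_pos.2 hq) (inv_lt_one_of_one_lt₀ h) hx]
    positivity

theorem one_le_qGamma_mul_of_lt_one {q x : ℝ} (hq : 0 < q) (h : q < 1) (hx : 0 < x) :
    1 ≤ qGamma q x * qGamma q (1 / x) := by
  rw [qGamma_eq_exp hq h hx, qGamma_eq_exp hq h (by positivity : 0 < 1 / x), ← Real.exp_add]
  exact Real.one_le_exp (logQGamma_add_nonneg hq h hx)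

theorem one_le_qGamma_mul {q x : ℝ} (hq : 0 < q) (hx : 0 < x) :
    1 ≤ qGamma q x * qGamma q (1 / x) := by
  rcases lt_trichotomy q 1 with h | rfl | h
  · exact one_le_qGamma_mul_of_lt_one hq h hx
  · simpa [qGamma] using Real.one_le_Gamma_mul_Gamma_one_div hx
  · have hp := one_le_qGamma_mul_of_lt_one (inv_pos.2 hq) (inv_lt_one_of_one_lt₀ h) hx
    rw [qGamma_eq_rpow_mul_qGamma_inv h, qGamma_eq_rpow_mul_qGamma_inv h, mul_mul_mul_comm,
      ← Real.rpow_add hq]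
    refine one_le_mul_of_one_le_of_one_le (Real.one_le_rpow h.le ?_) hp
    have e : (x - 1) * (x - 2) / 2 + (1 / x - 1) * (1 / x - 2) / 2 =
        (x - 1) ^ 2 * ((x - 1 / 2) ^ 2 + 3 / 4) / (2 * x ^ 2) := by
      field_simp
      ring
    rw [e]
    positivity

/-! ### The classical digamma function at `1` -/

theorem qGamma_one_left : qGamma 1 = Real.Gamma := by
  ext x
  simp [qGamma]

theorem Real.differentiableAt_Gamma_of_pos {x : ℝ} (hx : 0 < x) :
    DifferentiableAt ℝ Real.Gamma x :=
  Real.differentiableAt_Gamma fun m => by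
    have : (0 : ℝ) ≤ m := m.cast_nonneg
    linarith

theorem Real.differentiableAt_deriv_Gamma {x : ℝ} (hx : 0 < x) :
    DifferentiableAt ℝ (deriv Real.Gamma) x := by
  have hopen : IsOpen {s : ℂ | 0 < s.re} := isOpen_lt continuous_const Complex.continuous_re
  have hC {s : ℂ} (hs : 0 < s.re) : DifferentiableAt ℂ Complex.Gamma s := by
    refine Complex.differentiableAt_Gamma s fun m h => ?_
    have : (0 : ℝ) ≤ m := m.cast_nonneg
    rw [h] at hs
    simp at hs
    linarith
  have hd : DifferentiableOn ℂ (deriv Complex.Gamma) {s : ℂ | 0 < s.re} :=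
    DifferentiableOn.deriv (fun s hs => (hC hs).differentiableWithinAt) hopen
  have hx' : (x : ℂ) ∈ {s : ℂ | 0 < s.re} := by simpa using hx
  have h := ((hd.differentiableAt (hopen.mem_nhds hx')).hasDerivAt).real_of_complex
  refine (h.differentiableAt).congr_of_eventuallyEq ?_
  filter_upwards [Ioi_mem_nhds hx] with y hy
  have := (hC (s := (y : ℂ)) (by simpa using hy)).hasDerivAt.real_of_complex
  rw [← this.deriv]
  congr 1

theorem Real.differentiableAt_logDeriv_Gamma {x : ℝ} (hx : 0 < x) :
    DifferentiableAt ℝ (logDeriv Real.Gamma) x :=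
  (Real.differentiableAt_deriv_Gamma hx).div (Real.differentiableAt_Gamma_of_pos hx)
    (Real.Gamma_pos_of_pos hx).ne'

theorem Real.logDeriv_Gamma_add_one {x : ℝ} (hx : 0 < x) :
    logDeriv Real.Gamma (x + 1) = logDeriv Real.Gamma x + 1 / x := by
  have hG := (Real.differentiableAt_Gamma_of_pos hx).hasDerivAt
  have h1 : HasDerivAt (fun y => Real.Gamma (y + 1)) (deriv Real.Gamma (x + 1)) x :=
    (Real.differentiableAt_Gamma_of_pos (by linarith : 0 < x + 1)).hasDerivAt.comp_add_const x 1
  have h2 : HasDerivAt (fun y => Real.Gamma (y + 1))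
      (1 * Real.Gamma x + x * deriv Real.Gamma x) x := by
    refine ((hasDerivAt_id x).mul hG).congr_of_eventuallyEq ?_
    filter_upwards [Ioi_mem_nhds hx] with y hy
    exact Real.Gamma_add_one (ne_of_gt hy)
  have hpos := Real.Gamma_pos_of_pos hx
  rw [logDeriv_apply, logDeriv_apply, h1.unique h2, Real.Gamma_add_one hx.ne']
  field_simp
  ring

theorem Real.monotoneOn_logDeriv_Gamma : MonotoneOn (logDeriv Real.Gamma) (Ioi 0) := by
  have hd (x : ℝ) (hx : x ∈ Ioi (0 : ℝ)) :
      HasDerivAt (Real.log ∘ Real.Gamma) (logDeriv Real.Gamma x) x :=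
    (Real.differentiableAt_Gamma_of_pos hx).hasDerivAt.log (Real.Gamma_pos_of_pos hx).ne'
  refine (Real.convexOn_log_Gamma.monotoneOn_deriv
    fun x hx => (hd x hx).differentiableAt).congr fun x hx => (hd x hx).deriv

/-- These are the first two terms of `ψ'(1) = ∑ 1/n²`. -/
theorem Real.deriv_logDeriv_Gamma_one_ge : 5 / 4 ≤ deriv (logDeriv Real.Gamma) 1 := by
  have h3 : HasDerivAt (fun x => logDeriv Real.Gamma (x + 2))
      (deriv (logDeriv Real.Gamma) (1 + 2)) 1 :=
    (Real.differentiableAt_logDeriv_Gamma (by norm_num)).hasDerivAt.comp_add_const 1 2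
  have hnn : 0 ≤ deriv (logDeriv Real.Gamma) (1 + 2) := by
    rw [← derivWithin_of_isOpen isOpen_Ioi (by norm_num : (1 + 2 : ℝ) ∈ Ioi 0)]
    exact Real.monotoneOn_logDeriv_Gamma.derivWithin_nonneg
  have hi : HasDerivAt (fun x : ℝ => x⁻¹) (-((1 : ℝ) ^ 2)⁻¹) 1 := hasDerivAt_inv one_ne_zero
  have hi' : HasDerivAt (fun x : ℝ => (x + 1)⁻¹) (-((1 + 1 : ℝ) ^ 2)⁻¹) 1 :=
    (hasDerivAt_inv (by norm_num : (1 + 1 : ℝ) ≠ 0)).comp_add_const 1 1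
  have h : HasDerivAt (logDeriv Real.Gamma)
      (deriv (logDeriv Real.Gamma) (1 + 2) - -((1 : ℝ) ^ 2)⁻¹ - -((1 + 1 : ℝ) ^ 2)⁻¹) 1 := by
    refine ((h3.sub hi).sub hi').congr_of_eventuallyEq ?_
    filter_upwards [Ioi_mem_nhds one_pos] with x hx
    have hx : 0 < x := hx
    have ha := Real.logDeriv_Gamma_add_one hx
    have hb := Real.logDeriv_Gamma_add_one (by linarith : 0 < x + 1)
    rw [show x + 1 + 1 = x + 2 by ring] at hb
    simp only [Pi.sub_apply]
    rw [hb, ha]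
    simp only [one_div]
    ring
  rw [h.deriv]
  norm_num at hnn ⊢
  linarith

theorem one_mem_qGammaSetJ : (1 : ℝ) ∈ qGammaSetJ := by
  have hψ : qDigamma 1 = logDeriv Real.Gamma := by
    ext x
    rw [qDigamma, qGamma_one_left, logDeriv_apply]
  have h1 : logDeriv Real.Gamma 1 = -Real.eulerMascheroniConstant := by
    rw [logDeriv_apply, Real.hasDerivAt_Gamma_one.deriv, Real.Gamma_one, div_one]
  refine ⟨one_pos, ?_⟩
  rw [hψ, h1]
  have := Real.deriv_logDeriv_Gamma_one_ge
  have hlt := Real.eulerMascheroniConstant_lt_two_thirds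
  have hgt := Real.one_half_lt_eulerMascheroniConstant
  nlinarith

theorem mainTheorem2 :
    (1 : ℝ) ∈ qGammaSetJ ∧
      ∀ q ∈ qGammaSetJ, ∀ x : ℝ, 0 < x →
        2 ≤ qGamma q x + qGamma q (1 / x) ∧ 1 ≤ qGamma q x * qGamma q (1 / x) := by
  refine ⟨one_mem_qGammaSetJ, fun q hq x hx => ?_⟩
  have hprod := one_le_qGamma_mul hq.1 hx
  have ha := qGamma_pos hq.1 hx
  have hb := qGamma_pos hq.1 (by positivity : 0 < 1 / x)
  refine ⟨?_, hprod⟩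
  nlinarith [sq_nonneg (qGamma q x - qGamma q (1 / x))]
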